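/- All graphs are finite and simple. An integer partition of a positive integer $n$ is a list of positive integers $a_1\le\dots\le a_k$ with $a_1+\dots+a_k=n$. A graph $G=(V,E)$ on $n\ge 1$ vertices is \emph{recursively partitionable} (RP) if $G\simeq K_1$, or if $G$ is connected and for every integer partition $a_1,\dots,a_k$ of $n$ with $k\ge 2$ there is a partition $\{A_1,\dots,A_k\}$ of $V$ with $|A_i|=a_i$ such that every induced subgraph $G[A_i]$ is RP. For a positive integer $k$ and non-negative integers $b_1,\dots,b_k$, the \emph{balloon} $B(b_1,\dots,b_k)$ consists of two non-adjacent vertices $u,v$ and $k$ disjoint paths $P_1,\dots,P_k$, where $P_i$ has $b_i$ vertices, and (if $b_i\ge 1$) the first vertex of $P_i$ is adjacent to $u$ and the last vertex of $P_i$ is adjacent to $v$. Let $c(H)$ denote the number of connected components of a graph $H$. Let $G=(V,E)$ be a graph. (1) If $G$ has a spanning tree that is RP, then $c(G-S)\le |S|+2$ for every $S\subseteq V$. (2) If $G$ has a spanning subgraph that is isomorphic to a balloon and is RP, then $c(G-S)\le |S|+4$ for every $S\subseteq V$. -/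

import Mathlib

universe u

/-- `a₁ ≤ ⋯ ≤ a_k` is an integer partition of `n` into `k` positive parts. -/
def IsIntegerPartition (n : ℕ) {k : ℕ} (a : Fin k → ℕ) : Prop :=
  (∀ i, 0 < a i) ∧ Monotone a ∧ ∑ i, a i = n

/-- `A₁, …, A_k` is an `(a₁, …, a_k)`-partition of the vertex set `V`: the `A i` are pairwise
disjoint, cover `V`, and `|A i| = a i`. -/
def IsVertexPartition {V : Type u} {k : ℕ} (a : Fin k → ℕ) (A : Fin k → Set V) : Prop :=
  Pairwise (fun i j => Disjoint (A i) (A j)) ∧ (⋃ i, A i) = Set.univ ∧ ∀ i, (A i).ncard = a i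

theorem IsIntegerPartition.lt {n k : ℕ} {a : Fin k → ℕ} (h : IsIntegerPartition n a)
    (hk : 2 ≤ k) (i : Fin k) : a i < n := by
  obtain ⟨hpos, -, rfl⟩ := h
  obtain ⟨j, hj⟩ : ∃ j : Fin k, j ≠ i := by
    have : Nontrivial (Fin k) := Fin.nontrivial_iff_two_le.2 hk
    exact exists_ne i
  exact Finset.single_lt_sum hj (Finset.mem_univ i) (Finset.mem_univ j) (hpos j)
    (fun _ _ _ => Nat.zero_le _)

namespace SimpleGraph

/-- A finite graph `G` of order `n` is recursively partitionable (RP) if it has exactly one vertex,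
or it is connected and, for every integer partition `a₁, …, a_k` of `n`, there is an
`(a₁, …, a_k)`-partition `A₁, …, A_k` of the vertex set such that every `G[A i]` is RP.
The recursion runs over partitions into `k ≥ 2` parts: the only vertex partition with one part is
the whole vertex set, for which the condition reads "`G` is RP" and says nothing. -/
def IsRP {V : Type u} [Finite V] (G : SimpleGraph V) : Prop :=
  Nat.card V = 1 ∨
    (G.Connected ∧
      ∀ (k : ℕ) (_hk : 2 ≤ k) (a : Fin k → ℕ) (_ha : IsIntegerPartition (Nat.card V) a),
        ∃ (A : Fin k → Set V) (_hA : IsVertexPartition a A), ∀ i, IsRP (G.induce (A i)))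
termination_by Nat.card V
decreasing_by
  have h1 : Nat.card (A i) = a i := _hA.2.2 i
  have h2 := _ha.lt _hk i
  omega

/-- The number `c(G)` of connected components of `G`. -/
noncomputable def numComponents {V : Type u} (G : SimpleGraph V) : ℕ :=
  Nat.card G.ConnectedComponent

/-- The graph `G - S`, obtained by deleting the vertices in `S`. -/
abbrev minusVerts {V : Type u} (G : SimpleGraph V) (S : Set V) : SimpleGraph (Sᶜ : Set V) :=
  G.induce Sᶜ

/-- The balloon graph `B(b₁, …, b_k)`. The vertices `Sum.inl false` and `Sum.inl true` are the two
non-adjacent vertices `u` and `v`; the vertices `Sum.inr ⟨i, 0⟩, …, Sum.inr ⟨i, b i - 1⟩` form the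
path `P i`, in this order. The first vertex of `P i` is adjacent to `u`, the last one to `v`.
(A path with `b i = 0` has no vertices and contributes nothing.) -/
def balloon {k : ℕ} (b : Fin k → ℕ) : SimpleGraph (Bool ⊕ (Σ i : Fin k, Fin (b i))) :=
  SimpleGraph.fromRel fun x y =>
    match x, y with
    | Sum.inr p, Sum.inr q => p.1 = q.1 ∧ (p.2 : ℕ) + 1 = (q.2 : ℕ)
    | Sum.inl false, Sum.inr p => (p.2 : ℕ) = 0
    | Sum.inl true, Sum.inr p => (p.2 : ℕ) + 1 = b p.1
    | _, _ => False

/-- `H` is (isomorphic to) a balloon graph `B(b₁, …, b_k)` with `k ≥ 1` and `b i ≥ 0`. -/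
def IsBalloon {V : Type u} (H : SimpleGraph V) : Prop :=
  ∃ (k : ℕ) (b : Fin k → ℕ), 0 < k ∧ Nonempty (H ≃g balloon b)

end SimpleGraph

namespace SimpleGraph

/-! Passing to a spanning subgraph can only increase c(G - S), so it suffices to work in the RP
spanning subgraph H. Let U, with |U| ≤ t, contain every vertex of H of degree at least 3. Deleting S
∩ U, if nonempty, leaves at most 3|S ∩ U| ≤ |S ∩ U| + 2t components (`IsRP.ncard_image_compl_le`),
and each further deleted vertex has degree at most 2 and adds at most one
(`ncard_image_compl_le_of_ncard_neighborSet_le`).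

The bound 3|S| comes from cutting H into RP parts of sizes l and n - l. In a minimal counterexample
one part must be a whole component of H - S. Letting l run up to n/2 produces too many large
components for n vertices.

For a balloon, U consists of the two poles, so t = 2. For a tree, t = 1: two vertices of degree at
least 3 would give four branches, and every cut size must fit the sizes of these branches, which
`false_of_cut_sizes` excludes. -/

/-! ### Connectedness and cuts of RP graphs. -/

theorem Connected.forall_of_adj {V : Type*} {G : SimpleGraph V} (h : G.Connected) {P : V → Prop}
    (hP : ∀ v w, G.Adj v w → P v → P w) {a : V} (ha : P a) (b : V) : P b := by
  obtain ⟨p⟩ := h.preconnected a b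
  induction p with
  | nil => exact ha
  | cons hadj _ ih => exact ih (hP _ _ hadj ha)

theorem IsRP.connected {V : Type u} [Finite V] {G : SimpleGraph V} (h : G.IsRP) :
    G.Connected := by
  rw [IsRP] at h
  rcases h with h | h
  · have := (Nat.card_eq_one_iff_unique.1 h).1
    have := (Nat.card_eq_one_iff_unique.1 h).2
    exact ⟨fun a b => Subsingleton.elim a b ▸ Reachable.refl a⟩
  · exact h.1

theorem IsRP.exists_partition {V : Type u} [Finite V] {G : SimpleGraph V} (h : G.IsRP) {k : ℕ}
    (hk : 2 ≤ k) {a : Fin k → ℕ} (ha : IsIntegerPartition (Nat.card V) a) :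
    ∃ A : Fin k → Set V, IsVertexPartition a A ∧ ∀ i, (G.induce (A i)).IsRP := by
  rw [IsRP] at h
  rcases h with h | h
  · have h1 := ha.lt hk ⟨0, by omega⟩
    have h2 := ha.1 ⟨0, by omega⟩
    omega
  · obtain ⟨A, hA, hR⟩ := h.2 k hk a ha
    exact ⟨A, hA, hR⟩

/-- An RP graph can be cut into two RP parts of prescribed sizes. -/
theorem IsRP.exists_cut {V : Type u} [Finite V] {G : SimpleGraph V} (h : G.IsRP) {l r : ℕ}
    (hl : 0 < l) (hr : 0 < r) (hlr : l + r = Nat.card V) :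
    ∃ L : Set V, L.ncard = l ∧ Lᶜ.ncard = r ∧ (G.induce L).IsRP ∧ (G.induce Lᶜ).IsRP := by
  -- Integer partitions are sorted, so the smaller size has to come first.
  wlog hle : l ≤ r generalizing l r
  · obtain ⟨L, h1, h2, h3, h4⟩ := this hr hl (by omega) (by omega)
    exact ⟨Lᶜ, h2, by rwa [compl_compl], h4, by rwa [compl_compl]⟩
  obtain ⟨A, ⟨hdis, hun, hcard⟩, hR⟩ := h.exists_partition (k := 2) le_rfl (a := ![l, r])
    ⟨by simp [Fin.forall_fin_two, hl, hr],
      by intro i j hij; fin_cases i <;> fin_cases j <;> simp_all, by simp [hlr]⟩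
  have hc : A 1 = (A 0)ᶜ := by
    have hd : Disjoint (A 0) (A 1) := hdis (by decide)
    refine (IsCompl.compl_eq ⟨hd, ?_⟩).symm
    rw [codisjoint_iff]
    rw [Set.top_eq_univ, ← hun]
    ext v
    simp [Fin.exists_fin_two]
  refine ⟨A 0, hcard 0, ?_, hR 0, ?_⟩
  · rw [← hc]; exact hcard 1
  · rw [← hc]; exact hR 1

/-! ### Colourings that are constant along the edges outside a vertex set -/

/-- `f` is constant on the connected components of `G - S`. -/
def ConstOff {V : Type*} {α : Type*} (G : SimpleGraph V) (S : Set V) (f : V → α) : Prop :=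
  ∀ ⦃v w⦄, v ∉ S → w ∉ S → G.Adj v w → f v = f w

/-- If every colouring constant on the components of `G - S` takes at most `m` values outside `S`,
then `G - S` has at most `m` components. -/
theorem numComponents_minusVerts_le {V : Type u} [Finite V] {G : SimpleGraph V} {S : Set V} {m : ℕ}
    (h : ∀ {α : Type u} (f : V → α), G.ConstOff S f → (f '' Sᶜ).ncard ≤ m) :
    (G.minusVerts S).numComponents ≤ m := by
  classical
  let f : V → Option (G.minusVerts S).ConnectedComponent := fun v =>
    if hv : v ∈ Sᶜ then some (connectedComponentMk _ ⟨v, hv⟩) else none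
  have hf : G.ConstOff S f := by
    intro v w hv hw hadj
    have hv' : v ∈ Sᶜ := hv
    have hw' : w ∈ Sᶜ := hw
    simp only [f, hv', hw', dif_pos, Option.some.injEq]
    exact ConnectedComponent.sound (Adj.reachable (by simpa using hadj))
  refine le_trans ?_ (h f hf)
  rw [numComponents, ← Set.ncard_univ, ← Set.ncard_image_of_injective _
    (Option.some_injective (G.minusVerts S).ConnectedComponent)]
  refine Set.ncard_le_ncard ?_ (Set.toFinite _)
  rintro _ ⟨c, -, rfl⟩
  induction c using ConnectedComponent.ind with
  | h v => exact ⟨v, v.2, by simp only [f, v.2, dif_pos]⟩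

/-- Colourings pass to subgraphs and to induced parts without any comparison of component types;
this is why components are counted by colours. -/
theorem ConstOff.mono {V α : Type*} {G H : SimpleGraph V} {S : Set V} {f : V → α}
    (h : G.ConstOff S f) (hle : H ≤ G) : H.ConstOff S f :=
  fun _ _ hv hw hadj => h hv hw (hle hadj)

theorem ConstOff.induce {V α : Type*} {G : SimpleGraph V} {S : Set V} {f : V → α}
    (h : G.ConstOff S f) (A : Set V) :
    (G.induce A).ConstOff (Subtype.val ⁻¹' S) (fun v : A => f v) :=
  fun _ _ hv hw hadj => h hv hw hadj

theorem ncard_preimage_subtype_val {V : Type*} (A S : Set V) :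
    (Subtype.val ⁻¹' S : Set A).ncard = (A ∩ S).ncard := by
  rw [← Set.ncard_image_of_injective _ Subtype.val_injective, Subtype.image_preimage_coe]

theorem image_subtype_val_compl {V α : Type*} (A S : Set V) (f : V → α) :
    (fun v : A => f v) '' (Subtype.val ⁻¹' S)ᶜ = f '' (A \ S) := by
  ext c
  simp only [Set.mem_image, Set.mem_compl_iff, Set.mem_preimage, Subtype.exists, Set.mem_sdiff]
  exact ⟨fun ⟨v, hA, hS, h⟩ => ⟨v, ⟨hA, hS⟩, h⟩, fun ⟨v, ⟨hA, hS⟩, h⟩ => ⟨v, hA, hS, h⟩⟩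

/-! ### The bound of 3|S| components. -/

/-- If for every `l ≤ n / 2` some class of a colouring of `n - s` points with `3 s + 1` classes has
size `l` or `n - l`, then `s = 0`. -/
theorem eq_zero_of_class_sizes {α : Type*} {n s : ℕ} (F : Finset α) (size : α → ℕ)
    (hpos : ∀ c ∈ F, 0 < size c) (hsum : ∑ c ∈ F, size c + s = n) (hF : 3 * s < F.card)
    (hcut : ∀ l, 0 < l → 2 * l ≤ n → ∃ c ∈ F, size c = l ∨ size c + l = n) : s = 0 := by
  classical
  by_contra hs
  have hcut' : ∀ i : ℕ, ∃ c, i < n / 2 → c ∈ F ∧ (size c = i + 1 ∨ size c + (i + 1) = n) := by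
    intro i
    by_cases hi : i < n / 2
    · obtain ⟨c, hc⟩ := hcut (i + 1) (by omega) (by omega)
      exact ⟨c, fun _ => hc⟩
    · obtain ⟨c, -⟩ := Finset.card_pos.1 (by omega : 0 < F.card)
      exact ⟨c, fun h => absurd h hi⟩
  choose g hg using hcut'
  -- One class can serve l and l' only if l = l' or l + l' = n, and the latter also forces l = l'
  -- since both are at most n / 2.
  have hinj : Set.InjOn g (Finset.range (n / 2) : Set ℕ) := by
    intro i hi j hj hij
    simp only [Finset.coe_range, Set.mem_Iio] at hi hj
    have h1 := (hg i hi).2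
    have h2 := (hg j hj).2
    rw [hij] at h1
    omega
  have h1 : ∑ i ∈ Finset.range (n / 2), i ≤ ∑ i ∈ Finset.range (n / 2), (size (g i) - 1) := by
    refine Finset.sum_le_sum fun i hi => ?_
    have hi' := Finset.mem_range.1 hi
    have := (hg i hi').2
    omega
  have h2 : ∑ i ∈ Finset.range (n / 2), (size (g i) - 1) ≤ ∑ c ∈ F, (size c - 1) := by
    rw [← Finset.sum_image (f := fun c => size c - 1) hinj]
    refine Finset.sum_le_sum_of_subset fun c hc => ?_
    obtain ⟨i, hi, rfl⟩ := Finset.mem_image.1 hc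
    exact (hg i (Finset.mem_range.1 hi)).1
  have h3 : ∑ c ∈ F, (size c - 1) + F.card = ∑ c ∈ F, size c := by
    rw [Finset.card_eq_sum_ones, ← Finset.sum_add_distrib]
    refine Finset.sum_congr rfl fun c hc => ?_
    have := hpos c hc
    omega
  have h4 := Finset.sum_range_id_mul_two (n / 2)
  obtain ⟨N, hN⟩ : ∃ N, n / 2 = N := ⟨_, rfl⟩
  rw [hN] at h1 h2 h4
  -- The chosen classes give 0 + 1 + ... + (N - 1) ≤ n - s - |F|, where |F| ≥ 3s + 1 and n ≤ 2N + 1.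
  -- Hence N² - 5N + 8s ≤ 0, whereas N² - 5N ≥ -6 for integers N.
  have h5 : N * (N - 1) + 2 * (4 * s + 1) ≤ 2 * (2 * N + 1) := by omega
  have hNpos : 1 ≤ N := by omega
  obtain ⟨M, rfl⟩ := Nat.exists_eq_add_of_le' hNpos
  simp only [Nat.add_sub_cancel] at h5
  have : 1 ≤ s := by omega
  zify at h5 this
  nlinarith [sq_nonneg ((M : ℤ) - 1), sq_nonneg ((M : ℤ) - 2)]

/-- Deleting a nonempty set `S` from an RP graph leaves at most `3 |S|` components. -/
theorem IsRP.ncard_image_compl_le {α : Type*} {V : Type u} [Finite V] {G : SimpleGraph V}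
    (h : G.IsRP) {S : Set V} (hS : S.Nonempty) {f : V → α} (hf : G.ConstOff S f) :
    (f '' Sᶜ).ncard ≤ 3 * S.ncard := by
  classical
  induction hn : Nat.card V using Nat.strong_induction_on generalizing V with
  | _ n ih =>
  by_contra! hlt
  have hpart : ∀ {A : Set V}, (G.induce A).IsRP → A.ncard < n → (A ∩ S).Nonempty →
      (f '' (A \ S)).ncard ≤ 3 * (A ∩ S).ncard := by
    intro A hA hAn hAS
    have := ih A.ncard hAn hA (S := Subtype.val ⁻¹' S)
      (by obtain ⟨v, hv, hv'⟩ := hAS; exact ⟨⟨v, hv⟩, hv'⟩) (hf.induce A) rfl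
    rwa [ncard_preimage_subtype_val, image_subtype_val_compl] at this
  -- a part avoiding `S` is a full colour class
  have hclass : ∀ {A : Set V}, (G.induce A).IsRP → (G.induce Aᶜ).IsRP → Aᶜ.ncard < n →
      A ∩ S = ∅ → ∃ c ∈ f '' Sᶜ, {v | v ∉ S ∧ f v = c} = A := by
    intro A hA hAc hlt' hAS
    obtain ⟨⟨a, haA⟩⟩ := hA.connected.nonempty
    have hdis : ∀ v ∈ A, v ∉ S := fun v hv hvS => (hAS ▸ (⟨hv, hvS⟩ : v ∈ A ∩ S) : v ∈ (∅ : Set V))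
    have hconst : ∀ v ∈ A, f v = f a := fun v hv =>
      hA.connected.forall_of_adj (P := fun w : A => f w = f a)
        (fun v w hadj hv => by
          rw [← hv]; exact (hf (hdis v v.2) (hdis w w.2) hadj).symm) (a := ⟨a, haA⟩) rfl ⟨v, hv⟩
    have hSA : Aᶜ ∩ S = S := by
      ext v; exact ⟨fun h => h.2, fun h => ⟨fun hA => hdis v hA h, h⟩⟩
    have h1 := hpart hAc hlt' (by rwa [hSA])
    rw [hSA] at h1
    -- If the colour of A also occurred outside A, then Aᶜ would carry all the colours, but
    -- induction allows it only 3|S|.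
    have hnot : f a ∉ f '' (Aᶜ \ S) := by
      intro hmem
      have : f '' Sᶜ ⊆ f '' (Aᶜ \ S) := by
        rintro _ ⟨v, hv, rfl⟩
        by_cases hvA : v ∈ A
        · rw [hconst v hvA]; exact hmem
        · exact ⟨v, ⟨hvA, hv⟩, rfl⟩
      have := Set.ncard_le_ncard this (Set.toFinite _)
      omega
    refine ⟨f a, ⟨a, hdis a haA, rfl⟩, ?_⟩
    ext v
    refine ⟨fun hv => ?_, fun hv => ⟨hdis v hv, hconst v hv⟩⟩
    by_contra hvA
    exact hnot ⟨v, ⟨hvA, hv.1⟩, hv.2⟩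
  have : Fintype V := Fintype.ofFinite V
  have hs := eq_zero_of_class_sizes (n := n) (s := S.ncard) (Set.toFinite (f '' Sᶜ)).toFinset
    (fun c => {v | v ∉ S ∧ f v = c}.ncard) ?_ ?_ ?_ ?_
  · exact hS.ne_empty ((Set.ncard_eq_zero (Set.toFinite S)).1 hs)
  · intro c hc
    rw [Set.Finite.mem_toFinset] at hc
    obtain ⟨v, hv, rfl⟩ := hc
    exact (Set.ncard_pos (Set.toFinite _)).2 ⟨v, hv, rfl⟩
  · have h1 := Set.ncard_add_ncard_compl S
    have h2 := Finset.card_eq_sum_card_fiberwise (f := f) (s := Sᶜ.toFinset)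
      (t := (Set.toFinite (f '' Sᶜ)).toFinset) (by
        intro v hv
        simp only [Set.coe_toFinset] at hv
        simpa using ⟨v, hv, rfl⟩)
    rw [← Set.ncard_eq_toFinset_card'] at h2
    rw [add_comm, ← hn, ← h1, h2]
    congr 1
    refine Finset.sum_congr rfl fun c _ => ?_
    rw [← Set.ncard_coe_finset]
    congr 1
    ext v
    simp
  · rwa [← Set.ncard_eq_toFinset_card _ (Set.toFinite _)]
  · intro l hl hln
    obtain ⟨L, hL, hLc, hLR, hLcR⟩ := h.exists_cut (l := l) (r := n - l) hl (by omega) (by omega)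
    by_cases h1 : L ∩ S = ∅
    · obtain ⟨c, hc, he⟩ := hclass hLR hLcR (by omega) h1
      exact ⟨c, by simpa using hc, Or.inl (by simp only [he, hL])⟩
    by_cases h2 : Lᶜ ∩ S = ∅
    · obtain ⟨c, hc, he⟩ := hclass hLcR (by rwa [compl_compl]) (by rw [compl_compl]; omega) h2
      exact ⟨c, by simpa using hc, Or.inr (by simp only [he, hLc]; omega)⟩
    -- If both parts meet S, the two inductive bounds add up to 3|S|.
    exfalso
    have h3 := hpart hLR (by omega) (Set.nonempty_iff_ne_empty.2 h1)
    have h4 := hpart hLcR (by omega) (Set.nonempty_iff_ne_empty.2 h2)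
    have h5 : f '' Sᶜ = f '' (L \ S) ∪ f '' (Lᶜ \ S) := by
      rw [← Set.image_union, ← Set.union_sdiff_distrib, Set.union_compl_self,
        Set.compl_eq_univ_sdiff]
    have h6 := Set.ncard_union_le (f '' (L \ S)) (f '' (Lᶜ \ S))
    have h7 := Set.ncard_inter_add_ncard_sdiff_eq_ncard S L (Set.toFinite _)
    have h8 : Lᶜ ∩ S = S \ L := by rw [Set.inter_comm, ← Set.sdiff_eq]
    rw [Set.inter_comm] at h7
    rw [← h5] at h6
    rw [h8] at h4
    omega

/-! ### Deleting vertices of degree at most two. -/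

/-- Each deleted vertex with at most two neighbours creates at most one new component. -/
theorem ncard_image_compl_le_of_ncard_neighborSet_le {V : Type u} [Finite V] {G : SimpleGraph V}
    {S₀ : Set V} {m : ℕ}
    (h₀ : ∀ {α : Type u} (f : V → α), G.ConstOff S₀ f → (f '' S₀ᶜ).ncard ≤ m) {S : Set V}
    (hsub : S₀ ⊆ S) (hdeg : ∀ w ∈ S \ S₀, (G.neighborSet w).ncard ≤ 2)
    {α : Type u} (f : V → α) (hf : G.ConstOff S f) :
    (f '' Sᶜ).ncard ≤ m + (S \ S₀).ncard := by
  classical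
  obtain ⟨D, hD, hdis⟩ : ∃ D, S = S₀ ∪ D ∧ Disjoint S₀ D :=
    ⟨S \ S₀, (Set.union_sdiff_cancel hsub).symm, Set.disjoint_sdiff_right⟩
  have hSD : S \ S₀ = D := by
    rw [hD, Set.union_sdiff_left, sdiff_eq_left]; exact hdis.symm
  rw [hSD] at hdeg ⊢
  subst hD
  clear hSD hsub
  induction D, Set.toFinite D using Set.Finite.induction_on generalizing α with
  | empty =>
    rw [Set.union_empty] at hf ⊢
    simpa using h₀ f hf
  | @insert w D hw hfin ih =>
    rw [Set.ncard_insert_of_notMem hw hfin]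
    set S := S₀ ∪ D with hS
    have hSw : S₀ ∪ insert w D = insert w S := Set.union_insert
    rw [hSw] at hf ⊢
    have hwS : w ∉ S := by
      rintro (h | h)
      · exact (Set.disjoint_right.1 hdis (Set.mem_insert w D)) h
      · exact hw h
    -- merge the colours of the neighbours of `w`
    let f' : V → Option α := fun v =>
      if v = w ∨ f v ∈ f '' (G.neighborSet w) then none else some (f v)
    have hf' : G.ConstOff S f' := by
      intro v v' hv hv' hadj
      by_cases h1 : v = w
      · subst h1
        have : f v' ∈ f '' (G.neighborSet v) := ⟨v', hadj, rfl⟩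
        simp only [f', true_or, if_true, this, or_true]
      by_cases h2 : v' = w
      · subst h2
        have : f v ∈ f '' (G.neighborSet v') := ⟨v, hadj.symm, rfl⟩
        simp only [f', true_or, if_true, this, or_true]
      have := hf (v := v) (w := v') (by simp [h1, hv]) (by simp [h2, hv']) hadj
      simp only [f', h1, h2, this]
    have h1 := ih f' (fun v hv => hdeg v (Set.mem_insert_of_mem _ hv))
      (hdis.mono_right (Set.subset_insert _ _)) hf'
    have hnone : none ∈ f' '' Sᶜ := ⟨w, hwS, by simp [f']⟩
    -- Merging loses at most two colours, and the new colour `none`, always present at w, makes up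
    -- for one of them.
    have h2 : f '' (insert w S)ᶜ ⊆ (Option.some ⁻¹' (f' '' Sᶜ)) ∪ f '' (G.neighborSet w) := by
      rintro _ ⟨v, hv, rfl⟩
      simp only [Set.mem_compl_iff, Set.mem_insert_iff, not_or] at hv
      by_cases h : f v ∈ f '' (G.neighborSet w)
      · exact Or.inr h
      · refine Or.inl ⟨v, hv.2, ?_⟩
        simp only [f', hv.1, h, or_self, if_false]
    have hfin1 : (Option.some ⁻¹' (f' '' Sᶜ)).Finite :=
      (Set.toFinite (f' '' Sᶜ)).preimage (Option.some_injective α).injOn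
    have h3 := Set.ncard_le_ncard h2 (hfin1.union (Set.toFinite _))
    have h4 := Set.ncard_union_le (Option.some ⁻¹' (f' '' Sᶜ)) (f '' (G.neighborSet w))
    have h5 : (f '' (G.neighborSet w)).ncard ≤ 2 :=
      (Set.ncard_image_le (Set.toFinite _)).trans (hdeg w (Set.mem_insert _ _))
    have h6 : (Option.some ⁻¹' (f' '' Sᶜ)).ncard + 1 ≤ (f' '' Sᶜ).ncard := by
      rw [← Set.ncard_image_of_injective _ (Option.some_injective α),
        ← Set.ncard_insert_of_notMem (a := none) (by simp) (hfin1.image _)]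
      refine Set.ncard_le_ncard ?_ (Set.toFinite _)
      rintro _ (rfl | ⟨c, hc, rfl⟩)
      · exact hnone
      · exact hc
    omega

/-- A colouring of a connected graph that is constant along all edges uses one colour. -/
theorem Connected.ncard_image_le_one {V α : Type*} {G : SimpleGraph V} (h : G.Connected)
    {f : V → α} (hf : G.ConstOff ∅ f) : (f '' (∅ : Set V)ᶜ).ncard ≤ 1 := by
  obtain ⟨a⟩ := h.nonempty
  have : f '' (∅ : Set V)ᶜ ⊆ {f a} := by
    rintro _ ⟨v, -, rfl⟩
    exact h.forall_of_adj (P := fun v => f v = f a)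
      (fun v w hadj hv => by rw [← hv]; exact (hf (by simp) (by simp) hadj).symm) rfl v
  simpa using Set.ncard_le_ncard this (Set.toFinite _)

/-- If an RP graph `H` has at most two neighbours at every vertex outside `U`, with `|U| ≤ t`, and is a
spanning subgraph of `G`, the number of components of `G - S` exceeds `|S|` by at most `2 t`, for `t ≥ 1`. -/
theorem IsRP.numComponents_minusVerts_le {V : Type u} [Finite V] {G H : SimpleGraph V}
    (h : H.IsRP) (hle : H ≤ G) {U : Set V} {t : ℕ} (ht : 1 ≤ t) (hU : U.ncard ≤ t)
    (hdeg : ∀ w ∉ U, (H.neighborSet w).ncard ≤ 2) (S : Set V) :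
    (G.minusVerts S).numComponents ≤ S.ncard + 2 * t := by
  refine SimpleGraph.numComponents_minusVerts_le fun f hf => ?_
  have h1 := ncard_image_compl_le_of_ncard_neighborSet_le (G := H) (S₀ := S ∩ U)
    (m := (S ∩ U).ncard + 2 * t) (S := S) ?_ Set.inter_subset_left ?_ f (hf.mono hle)
  · have := Set.ncard_inter_add_ncard_sdiff_eq_ncard S (S ∩ U) (Set.toFinite _)
    rw [Set.inter_eq_self_of_subset_right Set.inter_subset_left] at this
    omega
  -- If S ∩ U is empty, connectedness gives one colour and t ≥ 1 suffices; otherwise 3|S ∩ U| ≤ |S ∩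
  -- U| + 2t.
  · intro β g hg
    rcases (S ∩ U).eq_empty_or_nonempty with h0 | h0
    · rw [h0] at hg ⊢
      have := h.connected.ncard_image_le_one hg
      omega
    · have h1 := h.ncard_image_compl_le h0 hg
      have h2 := Set.ncard_le_ncard (Set.inter_subset_right : S ∩ U ⊆ U) (Set.toFinite _)
      omega
  · rintro w ⟨hwS, hw⟩
    exact hdeg w fun hwU => hw ⟨hwS, hwU⟩

/-! ### Branches at a vertex -/

/-- `A` is a union of connected components of `G - x`. -/
def IsBranch {V : Type*} (G : SimpleGraph V) (x : V) (A : Set V) : Prop :=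
  x ∉ A ∧ ∀ ⦃v w⦄, v ∈ A → G.Adj v w → w ∈ A ∨ w = x

/-- `A` and `B` are disjoint nonempty branches at `x`. -/
structure IsBranchPair {V : Type*} (G : SimpleGraph V) (x : V) (A B : Set V) : Prop where
  left : G.IsBranch x A
  right : G.IsBranch x B
  left_nonempty : A.Nonempty
  right_nonempty : B.Nonempty
  disjoint : Disjoint A B

theorem IsBranch.induce {V : Type*} {G : SimpleGraph V} {x : V} {A : Set V} (h : G.IsBranch x A)
    {L : Set V} (hx : x ∈ L) : (G.induce L).IsBranch ⟨x, hx⟩ (Subtype.val ⁻¹' A) :=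
  ⟨h.1, fun _ _ hv hadj => (h.2 hv hadj).imp id Subtype.ext⟩

theorem IsBranchPair.symm {V : Type*} {G : SimpleGraph V} {x : V} {A B : Set V}
    (h : G.IsBranchPair x A B) : G.IsBranchPair x B A :=
  ⟨h.right, h.left, h.right_nonempty, h.left_nonempty, h.disjoint.symm⟩

theorem IsBranchPair.induce {V : Type*} {G : SimpleGraph V} {x : V} {A B : Set V}
    (h : G.IsBranchPair x A B) {L : Set V} (hx : x ∈ L) (hA : (L ∩ A).Nonempty)
    (hB : (L ∩ B).Nonempty) :
    (G.induce L).IsBranchPair ⟨x, hx⟩ (Subtype.val ⁻¹' A) (Subtype.val ⁻¹' B) :=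
  ⟨h.left.induce hx, h.right.induce hx, let ⟨v, hv, hv'⟩ := hA; ⟨⟨v, hv⟩, hv'⟩,
    let ⟨v, hv, hv'⟩ := hB; ⟨⟨v, hv⟩, hv'⟩, h.disjoint.preimage _⟩

/-- A connected set avoiding `x` that meets a branch at `x` lies inside it. -/
theorem IsBranch.subset_of_connected {V : Type*} {G : SimpleGraph V} {x : V} {A L : Set V}
    (h : G.IsBranch x A) (hL : (G.induce L).Connected) (hx : x ∉ L) (hne : (L ∩ A).Nonempty) :
    L ⊆ A := by
  obtain ⟨a, haL, haA⟩ := hne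
  intro v hv
  refine hL.forall_of_adj (P := fun w : L => (w : V) ∈ A) (fun v w hadj hvA => ?_)
    (a := ⟨a, haL⟩) haA ⟨v, hv⟩
  rcases h.2 hvA hadj with h1 | h1
  · exact h1
  · exact absurd (h1 ▸ w.2) hx

/-- Branches at different vertices, each avoiding the other vertex, are disjoint. -/
theorem IsBranch.disjoint_of_ne {V : Type*} {G : SimpleGraph V} (hG : G.Connected) {x y : V}
    (hxy : x ≠ y) {A C : Set V} (hA : G.IsBranch x A) (hC : G.IsBranch y C) (hyA : y ∉ A)
    (hxC : x ∉ C) : Disjoint A C := by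
  rw [Set.disjoint_left]
  intro v hvA hvC
  refine hA.1 (hG.forall_of_adj (P := fun w => w ∈ A ∧ w ∈ C) (fun v w hadj hv => ?_)
    (a := v) ⟨hvA, hvC⟩ x).1
  rcases hA.2 hv.1 hadj with h1 | rfl <;> rcases hC.2 hv.2 hadj with h2 | rfl
  · exact ⟨h1, h2⟩
  · exact absurd h1 hyA
  · exact absurd h2 hxC
  · exact absurd rfl hxy

/-- The vertices that lie neither at `x` nor in one of two branches form a branch. -/
theorem IsBranch.compl_union {V : Type*} {G : SimpleGraph V} {x : V} {A B : Set V}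
    (hA : G.IsBranch x A) (hB : G.IsBranch x B) : G.IsBranch x (insert x (A ∪ B))ᶜ := by
  refine ⟨by simp, fun v w hv hadj => ?_⟩
  simp only [Set.mem_compl_iff, Set.mem_insert_iff, Set.mem_union, not_or] at hv ⊢
  by_cases hw : w = x
  · exact Or.inr hw
  refine Or.inl ⟨hw, fun h => ?_, fun h => ?_⟩
  · rcases hA.2 h hadj.symm with h | h
    exacts [hv.2.1 h, hv.1 h]
  · rcases hB.2 h hadj.symm with h | h
    exacts [hv.2.2 h, hv.1 h]

theorem IsBranchPair.ncard_insert {V : Type*} [Finite V] {G : SimpleGraph V} {x : V} {A B : Set V}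
    (h : G.IsBranchPair x A B) : (insert x (A ∪ B)).ncard = A.ncard + B.ncard + 1 := by
  rw [Set.ncard_insert_of_notMem (by simp [h.left.1, h.right.1]) (Set.toFinite _),
    Set.ncard_union_eq h.disjoint]

theorem IsBranchPair.ncard_compl {V : Type*} [Finite V] {G : SimpleGraph V} {x : V} {A B : Set V}
    (h : G.IsBranchPair x A B) :
    A.ncard + B.ncard + 1 + (insert x (A ∪ B))ᶜ.ncard = Nat.card V := by
  rw [← h.ncard_insert, Set.ncard_add_ncard_compl]

/-! ### Restrictions on branch sizes in RP graphs. -/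

/-- Cutting an RP graph into parts of sizes `l ≤ r` needs a branch with at least `l` vertices. -/
theorem IsRP.le_ncard_branch {V : Type u} [Finite V] {G : SimpleGraph V} (h : G.IsRP) {x : V}
    {A B : Set V} (hAB : G.IsBranchPair x A B) {l r : ℕ} (hl : 0 < l) (hlr : l ≤ r)
    (hc : l + r = Nat.card V) :
    l ≤ A.ncard ∨ l ≤ B.ncard ∨ l ≤ (insert x (A ∪ B))ᶜ.ncard := by
  have key : ∀ L : Set V, (G.induce L).IsRP → x ∉ L → l ≤ L.ncard →
      l ≤ A.ncard ∨ l ≤ B.ncard ∨ l ≤ (insert x (A ∪ B))ᶜ.ncard := by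
    intro L hL hx hcard
    by_cases h1 : (L ∩ A).Nonempty
    · exact Or.inl (hcard.trans
        (Set.ncard_le_ncard (hAB.left.subset_of_connected hL.connected hx h1) (Set.toFinite _)))
    by_cases h2 : (L ∩ B).Nonempty
    · exact Or.inr (Or.inl (hcard.trans
        (Set.ncard_le_ncard (hAB.right.subset_of_connected hL.connected hx h2) (Set.toFinite _))))
    refine Or.inr (Or.inr (hcard.trans (Set.ncard_le_ncard ?_ (Set.toFinite _))))
    intro v hv
    simp only [Set.mem_compl_iff, Set.mem_insert_iff, Set.mem_union, not_or]
    exact ⟨fun h => hx (h ▸ hv), fun h => h1 ⟨v, hv, h⟩, fun h => h2 ⟨v, hv, h⟩⟩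
  -- Whichever part avoids x is connected and has at least l vertices, so it lies inside a single
  -- branch.
  obtain ⟨L, hL, hLc, hLR, hLcR⟩ := h.exists_cut hl (by omega) hc
  by_cases hx : x ∈ L
  · exact key Lᶜ hLcR (by simpa using hx) (by omega)
  · exact key L hLR hx (by omega)

/-- In a partition into parts of equal size `c`, branches smaller than `c` share the part of `x`. -/
theorem IsRP.ncard_branchPair_lt {V : Type u} [Finite V] {G : SimpleGraph V} (h : G.IsRP) {x : V}
    {A B : Set V} (hAB : G.IsBranchPair x A B) {k c : ℕ} (hk : 2 ≤ k) (hc : k * c = Nat.card V)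
    (hA : A.ncard < c) (hB : B.ncard < c) : A.ncard + B.ncard < c := by
  obtain ⟨P, ⟨hdis, hun, hcard⟩, hR⟩ := h.exists_partition hk (a := fun _ => c)
    ⟨fun _ => Nat.zero_lt_of_lt hA, fun _ _ _ => le_rfl, by simp [hc]⟩
  have hcov : ∀ v, ∃ i, v ∈ P i := fun v => by
    have : v ∈ ⋃ i, P i := hun ▸ Set.mem_univ v
    simpa using this
  obtain ⟨i, hi⟩ := hcov x
  have key : ∀ D : Set V, G.IsBranch x D → D.ncard < c → D ⊆ P i := by
    intro D hD hlt v hv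
    obtain ⟨j, hj⟩ := hcov v
    by_cases hij : j = i
    · exact hij ▸ hj
    -- A part meeting D but avoiding x would lie in D, which has fewer than c vertices.
    have hxj : x ∉ P j := fun hx => Set.disjoint_left.1 (hdis hij) hx hi
    have h1 := Set.ncard_le_ncard
      (hD.subset_of_connected (hR j).connected hxj ⟨v, hj, hv⟩) (Set.toFinite _)
    have h2 : (P j).ncard = c := hcard j
    omega
  have hsub : insert x (A ∪ B) ⊆ P i :=
    Set.insert_subset hi (Set.union_subset (key A hAB.left hA) (key B hAB.right hB))
  have h1 := Set.ncard_le_ncard hsub (Set.toFinite _)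
  have h2 : (P i).ncard = c := hcard i
  have h3 := hAB.ncard_insert
  omega

/-- Necessary conditions on the order `n` of an RP graph that has a vertex with two disjoint
branches of sizes `p` and `q`. -/
structure Admissible (n p q : ℕ) : Prop where
  le : p + q + 1 ≤ n
  eq_of_four : n = 4 → p + q = 3
  eq_of_six : n = 6 → p + q = 5
  nine : n = 9 → ¬(p = 1 ∧ q = 2) ∧ ¬(p = 2 ∧ q = 1) ∧ ¬(p = 2 ∧ q = 3) ∧ ¬(p = 3 ∧ q = 2)

/-- The vertices outside x, A and B act as a third branch D. Cuts into nearly equal halves require a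
large branch, and partitions into equal parts forbid two small branches from being too large
together. -/
theorem IsRP.admissible {V : Type u} [Finite V] {G : SimpleGraph V} (h : G.IsRP) {x : V}
    {A B : Set V} (hAB : G.IsBranchPair x A B) : Admissible (Nat.card V) A.ncard B.ncard := by
  have hsum := hAB.ncard_compl
  set D := (insert x (A ∪ B))ᶜ with hD
  have hA := (Set.ncard_pos (Set.toFinite _)).2 hAB.left_nonempty
  have hB := (Set.ncard_pos (Set.toFinite _)).2 hAB.right_nonempty
  refine ⟨by omega, fun hn => ?_, fun hn => ?_, fun hn => ?_⟩
  · by_contra hne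
    have := h.le_ncard_branch hAB (l := 2) (r := 2) (by omega) le_rfl (by omega)
    rw [← hD] at this
    omega
  · by_contra hne
    have hDne : D.Nonempty := (Set.ncard_pos (Set.toFinite _)).1 (by omega)
    have hDb : G.IsBranch x D := hAB.left.compl_union hAB.right
    have hAD : G.IsBranchPair x A D := ⟨hAB.left, hDb, hAB.left_nonempty, hDne,
      Set.disjoint_left.2 fun v hv hvD => hvD (Or.inr (Or.inl hv))⟩
    have hBD : G.IsBranchPair x B D := ⟨hAB.right, hDb, hAB.right_nonempty, hDne,
      Set.disjoint_left.2 fun v hv hvD => hvD (Or.inr (Or.inr hv))⟩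
    -- With D nonempty, the cut 3 + 3 forces branch sizes 3, 1, 1; then 2 + 2 + 2 fails at the two
    -- single vertices.
    have h3 := h.le_ncard_branch hAB (l := 3) (r := 3) (by omega) le_rfl (by omega)
    rw [← hD] at h3
    have h4 := h.ncard_branchPair_lt hAB (k := 3) (c := 2) (by omega) (by omega)
    have h5 := h.ncard_branchPair_lt hAD (k := 3) (c := 2) (by omega) (by omega)
    have h6 := h.ncard_branchPair_lt hBD (k := 3) (c := 2) (by omega) (by omega)
    omega
  -- The partition 3 + 3 + 3 excludes sizes 1 and 2; for sizes 2 and 3 the third branch has size 3,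
  -- and the cut 4 + 5 fails.
  · have h3 := h.ncard_branchPair_lt hAB (k := 3) (c := 3) (by omega) (by omega)
    have h4 := h.le_ncard_branch hAB (l := 4) (r := 5) (by omega) (by omega) (by omega)
    rw [← hD] at h4
    omega

theorem admissible_ncard_of_subset {V : Type u} [Finite V] {G : SimpleGraph V} {L : Set V}
    (hL : (G.induce L).IsRP) {x : V} (hx : x ∈ L) {A B : Set V} (hAB : G.IsBranchPair x A B)
    (hA : A ⊆ L) (hB : B ⊆ L) : Admissible L.ncard A.ncard B.ncard := by
  have := hL.admissible (hAB.induce hx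
    (by rw [Set.inter_eq_self_of_subset_right hA]; exact hAB.left_nonempty)
    (by rw [Set.inter_eq_self_of_subset_right hB]; exact hAB.right_nonempty))
  rwa [ncard_preimage_subtype_val, ncard_preimage_subtype_val,
    Set.inter_eq_self_of_subset_right hA, Set.inter_eq_self_of_subset_right hB] at this

/-! ### Excluding two branching vertices. -/

/-- The possible sizes of the branches at two vertices are contradictory. -/
theorem false_of_cut_sizes {n a b c d : ℕ} (ha : 0 < a) (hb : 0 < b) (hc : 0 < c) (hd : 0 < d)
    (hn : a + b + c + d + 2 ≤ n)
    (hcut : ∀ l, 0 < l → l < n →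
      (l = a ∨ l = b ∨ l = c ∨ l = d) ∨ Admissible l a b ∨ Admissible l c d) : False := by
  -- Cut sizes 1 and 2 are too small for a vertex with two branches, so both are sizes of branches.
  have h1 : a = 1 ∨ b = 1 ∨ c = 1 ∨ d = 1 := by
    rcases hcut 1 (by omega) (by omega) with h | h | h
    · omega
    · have := h.le; omega
    · have := h.le; omega
  have h2 : a = 2 ∨ b = 2 ∨ c = 2 ∨ d = 2 := by
    rcases hcut 2 (by omega) (by omega) with h | h | h
    · omega
    · have := h.le; omega
    · have := h.le; omega
  have h3 : (a = 3 ∨ b = 3 ∨ c = 3 ∨ d = 3) ∨ a + b = 2 ∨ c + d = 2 := by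
    rcases hcut 3 (by omega) (by omega) with h | h | h
    · omega
    · have := h.le; omega
    · have := h.le; omega
  have h4 : (a = 4 ∨ b = 4 ∨ c = 4 ∨ d = 4) ∨ a + b = 3 ∨ c + d = 3 := by
    rcases hcut 4 (by omega) (by omega) with h | h | h
    · omega
    · have := h.eq_of_four rfl; omega
    · have := h.eq_of_four rfl; omega
  have h6 : (a = 6 ∨ b = 6 ∨ c = 6 ∨ d = 6) ∨ a + b = 5 ∨ c + d = 5 := by
    rcases hcut 6 (by omega) (by omega) with h | h | h
    · omega
    · have := h.eq_of_six rfl; omega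
    · have := h.eq_of_six rfl; omega
  have h5 : (a = 5 ∨ b = 5 ∨ c = 5 ∨ d = 5) ∨ a + b ≤ 4 ∨ c + d ≤ 4 := by
    rcases hcut 5 (by omega) (by omega) with h | h | h
    · omega
    · have := h.le; omega
    · have := h.le; omega
  -- Up to symmetry, cut sizes up to 6 leave only the pairs {1, 2}, {2, 3} and {1, 2}, {3, 6}. Both
  -- have n ≥ 10, and the cut size 9 excludes them.
  have h9 : n ≤ 9 ∨ (a = 9 ∨ b = 9 ∨ c = 9 ∨ d = 9) ∨
      (a + b ≤ 8 ∧ ¬(a = 1 ∧ b = 2) ∧ ¬(a = 2 ∧ b = 1) ∧ ¬(a = 2 ∧ b = 3) ∧ ¬(a = 3 ∧ b = 2)) ∨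
      (c + d ≤ 8 ∧ ¬(c = 1 ∧ d = 2) ∧ ¬(c = 2 ∧ d = 1) ∧ ¬(c = 2 ∧ d = 3) ∧ ¬(c = 3 ∧ d = 2)) := by
    by_cases h0 : n ≤ 9
    · exact Or.inl h0
    rcases hcut 9 (by omega) (by omega) with h | h | h
    · omega
    · exact Or.inr (Or.inr (Or.inl ⟨by have := h.le; omega, h.nine rfl⟩))
    · exact Or.inr (Or.inr (Or.inr ⟨by have := h.le; omega, h.nine rfl⟩))
  clear hcut
  rcases h1 with rfl | rfl | rfl | rfl <;> rcases h2 with h2 | h2 | h2 | h2 <;>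
    omega

/-- In an RP graph there are no two vertices `x ≠ y` such that `x` has two disjoint branches not
containing `y`, and `y` has two disjoint branches not containing `x`. -/
theorem IsRP.not_two_branchPairs {V : Type u} [Finite V] {G : SimpleGraph V} (h : G.IsRP) {x y : V}
    (hxy : x ≠ y) {A B C D : Set V} (hAB : G.IsBranchPair x A B) (hCD : G.IsBranchPair y C D)
    (hyA : y ∉ A) (hyB : y ∉ B) (hxC : x ∉ C) (hxD : x ∉ D) : False := by
  induction hn : Nat.card V using Nat.strong_induction_on generalizing V with
  | _ n ih =>
  have hAC := hAB.left.disjoint_of_ne h.connected hxy hCD.left hyA hxC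
  have hAD := hAB.left.disjoint_of_ne h.connected hxy hCD.right hyA hxD
  have hBC := hAB.right.disjoint_of_ne h.connected hxy hCD.left hyB hxC
  have hBD := hAB.right.disjoint_of_ne h.connected hxy hCD.right hyB hxD
  -- a part avoiding `x` and `y` is one of the four branches
  have hleg : ∀ L : Set V, (G.induce L).IsRP → (G.induce Lᶜ).IsRP → Lᶜ.ncard < n → x ∉ L →
      y ∉ L → L = A ∨ L = B ∨ L = C ∨ L = D := by
    intro L hL hLc hlt hx hy
    have key : ∀ {z : V} {E : Set V}, G.IsBranch z E → E.Nonempty → z ∉ L →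
        ¬(Lᶜ ∩ E).Nonempty → L = E := by
      intro z E hE hne hz hemp
      have hEL : E ⊆ L := fun v hv => by
        by_contra hvL
        exact hemp ⟨v, hvL, hv⟩
      refine (hE.subset_of_connected hL.connected hz ?_).antisymm hEL
      rwa [Set.inter_eq_self_of_subset_right hEL]
    by_cases h1 : (Lᶜ ∩ A).Nonempty
    swap; · exact Or.inl (key hAB.left hAB.left_nonempty hx h1)
    by_cases h2 : (Lᶜ ∩ B).Nonempty
    swap; · exact Or.inr (Or.inl (key hAB.right hAB.right_nonempty hx h2))
    by_cases h3 : (Lᶜ ∩ C).Nonempty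
    swap; · exact Or.inr (Or.inr (Or.inl (key hCD.left hCD.left_nonempty hy h3)))
    by_cases h4 : (Lᶜ ∩ D).Nonempty
    swap; · exact Or.inr (Or.inr (Or.inr (key hCD.right hCD.right_nonempty hy h4)))
    -- If Lᶜ meets all four branches, it induces a smaller counterexample.
    exact (ih _ hlt hLc (x := ⟨x, hx⟩) (y := ⟨y, hy⟩) (by simpa using hxy)
      (hAB.induce hx h1 h2) (hCD.induce hy h3 h4) hyA hyB hxC hxD rfl).elim
  -- a branch at `z` avoiding `t` lies in the part of `z` if `t` lies in the other part
  have hside : ∀ {L E : Set V} {z t : V}, (G.induce Lᶜ).IsRP → G.IsBranch z E → z ∈ L → t ∉ L →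
      t ∉ E → E ⊆ L := by
    intro L E z t hLc hE hz ht htE v hv
    by_contra hvL
    exact htE (hE.subset_of_connected hLc.connected (by simpa using hz) ⟨v, hvL, hv⟩ ht)
  refine false_of_cut_sizes (n := n) (a := A.ncard) (b := B.ncard) (c := C.ncard) (d := D.ncard)
    ((Set.ncard_pos (Set.toFinite _)).2 hAB.left_nonempty)
    ((Set.ncard_pos (Set.toFinite _)).2 hAB.right_nonempty)
    ((Set.ncard_pos (Set.toFinite _)).2 hCD.left_nonempty)
    ((Set.ncard_pos (Set.toFinite _)).2 hCD.right_nonempty) ?_ ?_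
  · have hdis : Disjoint (insert x (A ∪ B)) (insert y (C ∪ D)) := by
      rw [Set.disjoint_left] at hAC hAD hBC hBD ⊢
      rintro v (rfl | hv | hv) (rfl | hw | hw)
      exacts [hxy rfl, hxC hw, hxD hw, hyA hv, hAC hv hw, hAD hv hw, hyB hv, hBC hv hw, hBD hv hw]
    have h1 := Set.ncard_union_eq hdis
    rw [hAB.ncard_insert, hCD.ncard_insert] at h1
    have h2 := Set.ncard_le_card (insert x (A ∪ B) ∪ insert y (C ∪ D))
    omega
  · intro l hl hln
    obtain ⟨L, rfl, hLc, hLR, hLcR⟩ := h.exists_cut (l := l) (r := n - l) hl (by omega) (by omega)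
    -- A part containing both vertices has a branch as its complement, so it keeps the two branches
    -- at the other vertex. A part containing just one vertex keeps both of its branches. A part
    -- containing neither is itself a branch.
    by_cases hx : x ∈ L <;> by_cases hy : y ∈ L
    · have h1 := hleg Lᶜ hLcR (by rwa [compl_compl]) (by rwa [compl_compl]) (by simpa) (by simpa)
      have hsub : ∀ {E F : Set V}, Lᶜ = E → Disjoint E F → F ⊆ L := by
        intro E F hE hEF
        rw [← hE] at hEF
        exact Set.disjoint_compl_left_iff_subset.1 hEF
      rcases h1 with h1 | h1 | h1 | h1
      · exact Or.inr (Or.inr (admissible_ncard_of_subset hLR hy hCD (hsub h1 hAC) (hsub h1 hAD)))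
      · exact Or.inr (Or.inr (admissible_ncard_of_subset hLR hy hCD (hsub h1 hBC) (hsub h1 hBD)))
      · exact Or.inr (Or.inl (admissible_ncard_of_subset hLR hx hAB
          (hsub h1 hAC.symm) (hsub h1 hBC.symm)))
      · exact Or.inr (Or.inl (admissible_ncard_of_subset hLR hx hAB
          (hsub h1 hAD.symm) (hsub h1 hBD.symm)))
    · exact Or.inr (Or.inl (admissible_ncard_of_subset hLR hx hAB
        (hside hLcR hAB.left hx hy hyA) (hside hLcR hAB.right hx hy hyB)))
    · exact Or.inr (Or.inr (admissible_ncard_of_subset hLR hy hCD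
        (hside hLcR hCD.left hy hx hxC) (hside hLcR hCD.right hy hx hxD)))
    · refine Or.inl ?_
      rcases hleg L hLR hLcR (by omega) hx hy with h1 | h1 | h1 | h1 <;> simp [← h1]

/-! ### Trees -/

/-- The branch of a tree at `x` behind the edge from `x` to `p`. -/
def edgeBranch {V : Type*} (T : SimpleGraph V) (x p : V) : Set V :=
  {v | (T.deleteEdges {s(x, p)}).Reachable p v}

/-- Every edge of a tree is a bridge, so the edge from p to x is the only way out of the branch. -/
theorem IsTree.adj_of_mem_edgeBranch {V : Type*} {T : SimpleGraph V} (hT : T.IsTree) {x p : V}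
    (hp : T.Adj x p) : x ∉ T.edgeBranch x p ∧ ∀ ⦃v w⦄, v ∈ T.edgeBranch x p → T.Adj v w →
      w ∈ T.edgeBranch x p ∨ (w = x ∧ v = p) := by
  have hx : x ∉ T.edgeBranch x p := fun h =>
    isBridge_iff.1 (isAcyclic_iff_forall_adj_isBridge.1 hT.isAcyclic hp) h.symm
  refine ⟨hx, fun v w hv hadj => ?_⟩
  by_cases he : s(v, w) = s(x, p)
  · rcases Sym2.eq_iff.1 he with ⟨rfl, rfl⟩ | ⟨rfl, rfl⟩
    · exact absurd hv hx
    · exact Or.inr ⟨rfl, rfl⟩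
  · exact Or.inl (Reachable.trans hv
      (Adj.reachable (by rw [deleteEdges_adj]; exact ⟨hadj, by simpa using he⟩)))

theorem IsTree.isBranch_edgeBranch {V : Type*} {T : SimpleGraph V} (hT : T.IsTree) {x p : V}
    (hp : T.Adj x p) : T.IsBranch x (T.edgeBranch x p) :=
  ⟨(hT.adj_of_mem_edgeBranch hp).1, fun _ _ hv hadj =>
    ((hT.adj_of_mem_edgeBranch hp).2 hv hadj).imp id And.left⟩

theorem IsTree.isBranchPair_edgeBranch {V : Type*} {T : SimpleGraph V} (hT : T.IsTree) {x p q : V}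
    (hp : T.Adj x p) (hq : T.Adj x q) (hpq : p ≠ q) :
    T.IsBranchPair x (T.edgeBranch x p) (T.edgeBranch x q) := by
  refine ⟨hT.isBranch_edgeBranch hp, hT.isBranch_edgeBranch hq, ⟨p, Reachable.refl p⟩,
    ⟨q, Reachable.refl q⟩, Set.disjoint_left.2 fun v hvp hvq => ?_⟩
  -- A common vertex would spread along edges to all of T, including x: leaving both branches at
  -- once needs an edge to x from a vertex equal to both p and q.
  refine (hT.adj_of_mem_edgeBranch hp).1 (hT.connected.forall_of_adj
    (P := fun w => w ∈ T.edgeBranch x p ∧ w ∈ T.edgeBranch x q) (fun v w hadj hv => ?_)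
    (a := v) ⟨hvp, hvq⟩ x).1
  rcases (hT.adj_of_mem_edgeBranch hp).2 hv.1 hadj with h1 | ⟨rfl, rfl⟩
  · rcases (hT.adj_of_mem_edgeBranch hq).2 hv.2 hadj with h2 | ⟨rfl, rfl⟩
    · exact ⟨h1, h2⟩
    · exact absurd h1 (hT.adj_of_mem_edgeBranch hp).1
  · rcases (hT.adj_of_mem_edgeBranch hq).2 hv.2 hadj with h2 | ⟨-, h2⟩
    · exact absurd h2 (hT.adj_of_mem_edgeBranch hq).1
    · exact absurd h2 hpq

/-- Of three pairwise disjoint branches at x, at most one contains y. -/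
theorem IsTree.exists_isBranchPair_of_two_lt {V : Type*} [Finite V] {T : SimpleGraph V}
    (hT : T.IsTree) {x : V} (hx : 2 < (T.neighborSet x).ncard) (y : V) :
    ∃ A B, T.IsBranchPair x A B ∧ y ∉ A ∧ y ∉ B := by
  obtain ⟨p, hp, q, hq, r, hr, hpq, hpr, hqr⟩ :=
    (Set.two_lt_ncard (Set.toFinite _)).1 hx
  have h1 := hT.isBranchPair_edgeBranch hp hq hpq
  have h2 := hT.isBranchPair_edgeBranch hp hr hpr
  have h3 := hT.isBranchPair_edgeBranch hq hr hqr
  by_cases hyp : y ∈ T.edgeBranch x p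
  · exact ⟨_, _, h3, Set.disjoint_left.1 h1.disjoint hyp, Set.disjoint_left.1 h2.disjoint hyp⟩
  by_cases hyq : y ∈ T.edgeBranch x q
  · exact ⟨_, _, h2, hyp, Set.disjoint_left.1 h3.disjoint hyq⟩
  · exact ⟨_, _, h1, hyp, hyq⟩

/-- An RP tree has at most one vertex of degree at least three. -/
theorem IsTree.ncard_two_lt_ncard_neighborSet_le_one {V : Type u} [Finite V] {T : SimpleGraph V}
    (hT : T.IsTree) (h : T.IsRP) : {x | 2 < (T.neighborSet x).ncard}.ncard ≤ 1 := by
  refine (Set.ncard_le_one (Set.toFinite _)).2 fun x hx y hy => ?_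
  by_contra hxy
  obtain ⟨A, B, hAB, hA, hB⟩ := hT.exists_isBranchPair_of_two_lt hx y
  obtain ⟨C, D, hCD, hC, hD⟩ := hT.exists_isBranchPair_of_two_lt hy x
  exact h.not_two_branchPairs hxy hAB hCD hA hB hC hD

/-! ### Balloons -/

theorem ncard_pair_le_two {V : Type*} (v w : V) : ({v, w} : Set V).ncard ≤ 2 :=
  (Set.ncard_insert_le v {w}).trans (by rw [Set.ncard_singleton])

theorem ncard_neighborSet_balloon_le_two {k : ℕ} (b : Fin k → ℕ) (p : Σ i : Fin k, Fin (b i)) :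
    ((balloon b).neighborSet (Sum.inr p)).ncard ≤ 2 := by
  classical
  obtain ⟨i, j⟩ := p
  -- The only possible neighbours are the predecessor and the successor on the path, with u before
  -- the first vertex and v after the last.
  let prev : Bool ⊕ (Σ i : Fin k, Fin (b i)) :=
    if (j : ℕ) = 0 then Sum.inl false else Sum.inr ⟨i, ⟨j - 1, by omega⟩⟩
  let next : Bool ⊕ (Σ i : Fin k, Fin (b i)) :=
    if h : (j : ℕ) + 1 = b i then Sum.inl true else Sum.inr ⟨i, ⟨j + 1, by omega⟩⟩
  have hsub : (balloon b).neighborSet (Sum.inr ⟨i, j⟩) ⊆ {prev, next} := by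
    intro w hw
    simp only [mem_neighborSet, balloon, fromRel_adj] at hw
    simp only [Set.mem_insert_iff, Set.mem_singleton_iff, prev, next]
    rcases w with (_ | _) | ⟨i', j'⟩
    · left
      simp_all
    · right
      simp_all
    · rcases hw.2 with ⟨rfl, h⟩ | ⟨rfl, h⟩
      · right
        have hj' := j'.2
        simp only at h
        rw [dif_neg (by omega)]
        congr 2
        exact Fin.ext h.symm
      · left
        simp only at h
        rw [if_neg (by omega)]
        congr 2
        exact Fin.ext (by simp only; omega)
  exact (Set.ncard_le_ncard hsub (Set.toFinite _)).trans (ncard_pair_le_two _ _)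

theorem IsBalloon.exists_ncard_neighborSet_le_two {V : Type*} [Finite V] {H : SimpleGraph V}
    (h : H.IsBalloon) : ∃ U : Set V, U.ncard ≤ 2 ∧ ∀ w ∉ U, (H.neighborSet w).ncard ≤ 2 := by
  obtain ⟨k, b, -, ⟨φ⟩⟩ := h
  refine ⟨{φ.symm (Sum.inl false), φ.symm (Sum.inl true)}, ncard_pair_le_two _ _, fun w hw => ?_⟩
  have hφ : φ '' H.neighborSet w ⊆ (balloon b).neighborSet (φ w) := by
    rintro _ ⟨v, hv, rfl⟩
    exact φ.map_adj_iff.2 hv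
  rw [← Set.ncard_image_of_injective _ φ.injective]
  refine (Set.ncard_le_ncard hφ (Set.toFinite _)).trans ?_
  rcases hp : φ w with (_ | _) | p
  · exact absurd (Or.inl (by rw [← hp]; simp)) hw
  · exact absurd (Or.inr (by rw [Set.mem_singleton_iff, ← hp]; simp)) hw
  · exact ncard_neighborSet_balloon_le_two b p

end SimpleGraph

theorem mainTheorem8 {V : Type*} [Finite V] (G : SimpleGraph V) :
    ((∃ T : SimpleGraph V, T ≤ G ∧ T.IsTree ∧ T.IsRP) →
      ∀ S : Set V, (G.minusVerts S).numComponents ≤ S.ncard + 2) ∧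
    ((∃ B : SimpleGraph V, B ≤ G ∧ B.IsBalloon ∧ B.IsRP) →
      ∀ S : Set V, (G.minusVerts S).numComponents ≤ S.ncard + 4) := by
  refine ⟨fun ⟨T, hle, hT, hRP⟩ S => ?_, fun ⟨B, hle, hB, hRP⟩ S => ?_⟩
  -- Here t = 1, with U the set of vertices of degree at least 3; for balloons t = 2.
  · exact hRP.numComponents_minusVerts_le hle le_rfl
      (hT.ncard_two_lt_ncard_neighborSet_le_one hRP) (fun w hw => not_lt.1 hw) S
  · obtain ⟨U, hU, hdeg⟩ := hB.exists_ncard_neighborSet_le_two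
    exact hRP.numComponents_minusVerts_le hle one_le_two hU hdeg S
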